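/- Let $\mathcal H_0,\mathcal H_1,\mathcal K_1$ be complex Hilbert spaces, and let $T_0\in\mathcal B(\mathcal H_0)$, $T_1\in\mathcal B(\mathcal H_1)$, $V_1\in\mathcal B(\mathcal K_1)$, $K\in\mathcal B(\mathcal H_1,\mathcal K_1)$, $A\in\mathcal B(\mathcal H_1,\mathcal H_0)$ be bounded linear operators. Let $\mathcal H=\mathcal H_0\oplus\mathcal H_1$ and $\mathcal K=\mathcal K_1\oplus\mathcal H_1$ be the orthogonal sums, and set $$V=\begin{pmatrix}V_1&K\\0&T_1\end{pmatrix}\in\mathcal B(\mathcal K),\qquad R=\begin{pmatrix}T_0&A\\0&T_1\end{pmatrix}\in\mathcal B(\mathcal H),\qquad R_0=\begin{pmatrix}T_0&0&A\\0&V_1&K\\0&0&T_1\end{pmatrix}\in\mathcal B(\mathcal H_0\oplus\mathcal K_1\oplus\mathcal H_1)=\mathcal B(\mathcal H_0\oplus\mathcal K).$$ An operator $S$ is called power bounded if $\sup_{n\ge1}\|S^n\|<\infty$, and polynomially bounded if there is a constant $M>0$ such that $\|p(S)\|\le M\sup\{|p(z)|:|z|\le1\}$ for every complex polynomial $p$.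 It is similar to a contraction if there are a Hilbert space $\mathcal L$, an operator $T\in\mathcal B(\mathcal L)$ with $\|T\|\le1$, and a bounded operator $X$ with bounded inverse from the space of $S$ onto $\mathcal L$ such that $XS=TX$. Then $\mathcal K_1$ is an invariant subspace of $R_0$, and with respect to the representation of $\mathcal H_0\oplus\mathcal K$ as $\mathcal K_1\oplus\mathcal H$ (permuting the components) $R_0$ has the form $$R_0=\begin{pmatrix}V_1&B\\0&R\end{pmatrix}\quad\text{for some } B\in\mathcal B(\mathcal H,\mathcal K_1).$$ Moreover: (1) If $V$ is power bounded, then $R$ is power bounded if and only if $R_0$ is power bounded. If $V$ is polynomially bounded, then $R$ is polynomially bounded if and only if $R_0$ is polynomially bounded. (2) If $V$ is an isometry, then $R$ is similar to a contraction if and only if $R_0$ is similar to a contraction. -/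

import Mathlib

noncomputable section

namespace BlockOperators

universe u v w

section Classes

/-- `R` is power bounded: `sup_{n ≥ 1} ‖R ^ n‖ < ∞`. -/
def PowerBounded {H : Type u} [NormedAddCommGroup H] [InnerProductSpace ℂ H]
    (R : H →L[ℂ] H) : Prop :=
  ∃ C : ℝ, ∀ n : ℕ, 1 ≤ n → ‖R ^ n‖ ≤ C

/-- `R` is polynomially bounded: for some `M > 0` every complex polynomial `p` satisfies
`‖p(R)‖ ≤ M * sup {|p(z)| : |z| ≤ 1}`. -/
def PolynomiallyBounded {H : Type u} [NormedAddCommGroup H] [InnerProductSpace ℂ H]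
    (R : H →L[ℂ] H) : Prop :=
  ∃ M : ℝ, 0 < M ∧ ∀ p : Polynomial ℂ,
    ‖Polynomial.aeval R p‖ ≤ M * ⨆ z : Metric.closedBall (0 : ℂ) 1, ‖p.eval (z : ℂ)‖

/-- `R` and `T` are similar: `X R = T X` for some bounded operator `X` with a bounded inverse. -/
def Similar {H : Type u} {L : Type v} [NormedAddCommGroup H] [InnerProductSpace ℂ H]
    [NormedAddCommGroup L] [InnerProductSpace ℂ L]
    (R : H →L[ℂ] H) (T : L →L[ℂ] L) : Prop :=
  ∃ X : H ≃L[ℂ] L, (X : H →L[ℂ] L) ∘L R = T ∘L (X : H →L[ℂ] L)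

/-- `R` is similar to a contraction, acting on some Hilbert space. -/
def SimilarToContraction {H : Type u} [NormedAddCommGroup H] [InnerProductSpace ℂ H]
    (R : H →L[ℂ] H) : Prop :=
  ∃ (L : Type u) (_ : NormedAddCommGroup L) (_ : InnerProductSpace ℂ L) (_ : CompleteSpace L)
    (T : L →L[ℂ] L), ‖T‖ ≤ 1 ∧ Similar R T

end Classes

section Blocks

variable {E : Type u} {F : Type v} {G : Type w}
  [NormedAddCommGroup E] [InnerProductSpace ℂ E]
  [NormedAddCommGroup F] [InnerProductSpace ℂ F]
  [NormedAddCommGroup G] [InnerProductSpace ℂ G]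

/-- The operator on the orthogonal sum `E ⊕ F` with the given `2 × 2` operator matrix
(rows listed from the top). -/
def block2 (a₁₁ : E →L[ℂ] E) (a₁₂ : F →L[ℂ] E) (a₂₁ : E →L[ℂ] F) (a₂₂ : F →L[ℂ] F) :
    WithLp 2 (E × F) →L[ℂ] WithLp 2 (E × F) :=
  ((WithLp.prodContinuousLinearEquiv 2 ℂ E F).symm : (E × F) →L[ℂ] WithLp 2 (E × F)) ∘L
    ((a₁₁ ∘L WithLp.fstL 2 ℂ E F + a₁₂ ∘L WithLp.sndL 2 ℂ E F).prod
      (a₂₁ ∘L WithLp.fstL 2 ℂ E F + a₂₂ ∘L WithLp.sndL 2 ℂ E F))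

theorem block2_apply (a₁₁ : E →L[ℂ] E) (a₁₂ : F →L[ℂ] E) (a₂₁ : E →L[ℂ] F) (a₂₂ : F →L[ℂ] F)
    (x : WithLp 2 (E × F)) :
    block2 a₁₁ a₁₂ a₂₁ a₂₂ x =
      WithLp.toLp 2 (a₁₁ x.fst + a₁₂ x.snd, a₂₁ x.fst + a₂₂ x.snd) := rfl

/-- The operator on the orthogonal sum `E ⊕ (F ⊕ G)` with the given `3 × 3` operator matrix
with respect to `E`, `F`, `G` (rows listed from the top). -/
def block3
    (a₁₁ : E →L[ℂ] E) (a₁₂ : F →L[ℂ] E) (a₁₃ : G →L[ℂ] E)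
    (a₂₁ : E →L[ℂ] F) (a₂₂ : F →L[ℂ] F) (a₂₃ : G →L[ℂ] F)
    (a₃₁ : E →L[ℂ] G) (a₃₂ : F →L[ℂ] G) (a₃₃ : G →L[ℂ] G) :
    WithLp 2 (E × WithLp 2 (F × G)) →L[ℂ] WithLp 2 (E × WithLp 2 (F × G)) :=
  let π₁ : WithLp 2 (E × WithLp 2 (F × G)) →L[ℂ] E := WithLp.fstL 2 ℂ E (WithLp 2 (F × G))
  let π₂ : WithLp 2 (E × WithLp 2 (F × G)) →L[ℂ] F :=
    WithLp.fstL 2 ℂ F G ∘L WithLp.sndL 2 ℂ E (WithLp 2 (F × G))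
  let π₃ : WithLp 2 (E × WithLp 2 (F × G)) →L[ℂ] G :=
    WithLp.sndL 2 ℂ F G ∘L WithLp.sndL 2 ℂ E (WithLp 2 (F × G))
  ((WithLp.prodContinuousLinearEquiv 2 ℂ E (WithLp 2 (F × G))).symm :
      (E × WithLp 2 (F × G)) →L[ℂ] WithLp 2 (E × WithLp 2 (F × G))) ∘L
    ((a₁₁ ∘L π₁ + a₁₂ ∘L π₂ + a₁₃ ∘L π₃).prod
      (((WithLp.prodContinuousLinearEquiv 2 ℂ F G).symm : (F × G) →L[ℂ] WithLp 2 (F × G)) ∘L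
        ((a₂₁ ∘L π₁ + a₂₂ ∘L π₂ + a₂₃ ∘L π₃).prod
          (a₃₁ ∘L π₁ + a₃₂ ∘L π₂ + a₃₃ ∘L π₃))))

theorem block3_apply
    (a₁₁ : E →L[ℂ] E) (a₁₂ : F →L[ℂ] E) (a₁₃ : G →L[ℂ] E)
    (a₂₁ : E →L[ℂ] F) (a₂₂ : F →L[ℂ] F) (a₂₃ : G →L[ℂ] F)
    (a₃₁ : E →L[ℂ] G) (a₃₂ : F →L[ℂ] G) (a₃₃ : G →L[ℂ] G)
    (x : WithLp 2 (E × WithLp 2 (F × G))) :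
    block3 a₁₁ a₁₂ a₁₃ a₂₁ a₂₂ a₂₃ a₃₁ a₃₂ a₃₃ x =
      WithLp.toLp 2 (a₁₁ x.fst + a₁₂ x.snd.fst + a₁₃ x.snd.snd,
        WithLp.toLp 2 (a₂₁ x.fst + a₂₂ x.snd.fst + a₂₃ x.snd.snd,
          a₃₁ x.fst + a₃₂ x.snd.fst + a₃₃ x.snd.snd)) := rfl

variable (E F G)

/-- The summand `F` of `E ⊕ (F ⊕ G)`, as a subspace: the vectors whose components in `E` and `G`
vanish. -/
def middleSummand : Submodule ℂ (WithLp 2 (E × WithLp 2 (F × G))) where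
  carrier := {x | x.fst = 0 ∧ x.snd.snd = 0}
  add_mem' := by
    rintro x y ⟨hx₁, hx₂⟩ ⟨hy₁, hy₂⟩
    simp [hx₁, hx₂, hy₁, hy₂]
  zero_mem' := by simp
  smul_mem' := by
    rintro c x ⟨hx₁, hx₂⟩
    simp [hx₁, hx₂]

/-- The unitary identification of `E ⊕ (F ⊕ G)` with `F ⊕ (E ⊕ G)` that permutes the
components. -/
def reorder : WithLp 2 (E × WithLp 2 (F × G)) ≃ₗᵢ[ℂ] WithLp 2 (F × WithLp 2 (E × G)) where
  toFun x := WithLp.toLp 2 (x.snd.fst, WithLp.toLp 2 (x.fst, x.snd.snd))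
  invFun y := WithLp.toLp 2 (y.snd.fst, WithLp.toLp 2 (y.fst, y.snd.snd))
  left_inv _ := rfl
  right_inv _ := rfl
  map_add' _ _ := rfl
  map_smul' _ _ := rfl
  norm_map' x := by
    change ‖(WithLp.toLp 2 (x.snd.fst, WithLp.toLp 2 (x.fst, x.snd.snd)) :
      WithLp 2 (F × WithLp 2 (E × G)))‖ = ‖x‖
    rw [← sq_eq_sq₀ (norm_nonneg _) (norm_nonneg _)]
    simp only [WithLp.prod_norm_sq_eq_of_L2, WithLp.toLp_fst, WithLp.toLp_snd]
    ring

theorem reorder_apply (x : WithLp 2 (E × WithLp 2 (F × G))) :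
    reorder E F G x = WithLp.toLp 2 (x.snd.fst, WithLp.toLp 2 (x.fst, x.snd.snd)) := rfl

end Blocks

end BlockOperators

end

/-!
Let `P` and `Q` be the projections of `H₀ ⊕ K₁ ⊕ H₁` onto `H₀ ⊕ H₁` and `K₁ ⊕ H₁`, so that
`P R₀ = R P` and `Q R₀ = V Q`. Since `P` has a right inverse `J`, the operator `R` is a quotient of
`R₀`; since `Z₁ P + Z₂ Q = 1` for suitable `Z₁` and `Z₂`, the operator `R₀` is a subdirect sum of
`R` and `V`: up to similarity, a restriction of `R ⊕ V` to an invariant subspace. Hence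
`p(R) = P p(R₀) J` and `p(R₀) = Z₁ p(R) P + Z₂ p(V) Q` for every polynomial `p`, and norm bounds on
polynomials pass in both directions.

An operator `S` is similar to a contraction as soon as `‖W S x‖ ≤ ‖W x‖` for some `W` with a bounded
left inverse, because then `|W| S |W|⁻¹` is a contraction. For a subdirect sum, `W` is assembled
from the two given similarities. For a quotient of a contraction, `W` is the lift into the
orthogonal complement of the kernel of the quotient map.
-/

namespace BlockOperators

open ContinuousLinearMap
open Polynomial (X aeval aeval_X aeval_eq_sum_range)
open scoped Polynomial NNReal Topology

section PolynomialCalculus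

variable {𝕜 E F G : Type*} [NontriviallyNormedField 𝕜]
  [NormedAddCommGroup E] [NormedSpace 𝕜 E] [NormedAddCommGroup F] [NormedSpace 𝕜 F]
  [NormedAddCommGroup G] [NormedSpace 𝕜 G]
  {S : E →L[𝕜] E} {R : F →L[𝕜] F} {V : G →L[𝕜] G} {P : E →L[𝕜] F}

theorem comp_pow_of_comp_eq (hP : P ∘L S = R ∘L P) (n : ℕ) : P ∘L (S ^ n) = (R ^ n) ∘L P := by
  have hsemi : Function.Semiconj P S R := DFunLike.congr_fun hP
  ext x
  simpa only [comp_apply, FunLike.coe_pow_eq_iterate] using hsemi.iterate_right n x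

theorem comp_aeval_of_comp_eq (hP : P ∘L S = R ∘L P) (p : 𝕜[X]) :
    P ∘L aeval S p = aeval R p ∘L P := by
  simp only [aeval_eq_sum_range, finsetSum_comp, comp_finsetSum, comp_smul, smul_comp,
    comp_pow_of_comp_eq hP]

theorem norm_aeval_le_of_quotient {J : F →L[𝕜] E} (hPJ : P ∘L J = .id 𝕜 F)
    (hP : P ∘L S = R ∘L P) (p : 𝕜[X]) :
    ‖aeval R p‖ ≤ ‖P‖ * ‖J‖ * ‖aeval S p‖ := by
  have hR : aeval R p = P ∘L aeval S p ∘L J := by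
    rw [← comp_assoc, comp_aeval_of_comp_eq hP, comp_assoc, hPJ, comp_id]
  calc ‖aeval R p‖ ≤ ‖P‖ * (‖aeval S p‖ * ‖J‖) := by
        rw [hR]
        exact (opNorm_comp_le _ _).trans (by gcongr; exact opNorm_comp_le _ _)
    _ = ‖P‖ * ‖J‖ * ‖aeval S p‖ := by ring

theorem norm_aeval_le_of_subdirectSum {Q : E →L[𝕜] G} {Z₁ : F →L[𝕜] E} {Z₂ : G →L[𝕜] E}
    (hZ : Z₁ ∘L P + Z₂ ∘L Q = .id 𝕜 E) (hP : P ∘L S = R ∘L P) (hQ : Q ∘L S = V ∘L Q)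
    (p : 𝕜[X]) :
    ‖aeval S p‖ ≤ ‖Z₁‖ * ‖P‖ * ‖aeval R p‖ + ‖Z₂‖ * ‖Q‖ * ‖aeval V p‖ := by
  have hS : aeval S p = Z₁ ∘L aeval R p ∘L P + Z₂ ∘L aeval V p ∘L Q := by
    rw [← comp_aeval_of_comp_eq hP, ← comp_aeval_of_comp_eq hQ, ← comp_assoc, ← comp_assoc,
      ← add_comp, hZ, id_comp]
  calc ‖aeval S p‖ ≤ ‖Z₁‖ * (‖aeval R p‖ * ‖P‖) + ‖Z₂‖ * (‖aeval V p‖ * ‖Q‖) := by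
        rw [hS]
        refine (norm_add_le _ _).trans (add_le_add ?_ ?_) <;>
          exact (opNorm_comp_le _ _).trans (by gcongr; exact opNorm_comp_le _ _)
    _ = ‖Z₁‖ * ‖P‖ * ‖aeval R p‖ + ‖Z₂‖ * ‖Q‖ * ‖aeval V p‖ := by ring

end PolynomialCalculus

theorem completeSpace_of_leftInverse {α β : Type*} [UniformSpace α] [UniformSpace β]
    [CompleteSpace β] {f : α → β} {g : β → α} (hgf : Function.LeftInverse g f)
    (hf : UniformContinuous f) (hg : Continuous g) : CompleteSpace α where
  complete {l} hl := by
    obtain ⟨y, hy⟩ := CompleteSpace.complete (hl.map hf)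
    refine ⟨g y, ?_⟩
    calc l = (l.map f).map g := by rw [Filter.map_map, hgf.comp_eq_id, Filter.map_id]
      _ ≤ (𝓝 y).map g := Filter.map_mono hy
      _ ≤ 𝓝 (g y) := hg.continuousAt

section KerOrthogonal

variable {𝕜 E F : Type*} [RCLike 𝕜] [NormedAddCommGroup E] [InnerProductSpace 𝕜 E]
  [CompleteSpace E] [NormedAddCommGroup F] [NormedSpace 𝕜 F] (P : E →L[𝕜] F)

theorem apply_starProjection_orthogonal_ker (x : E) : P (P.kerᗮ.starProjection x) = P x := by
  have hker : P (P.ker.starProjection x) = 0 := P.ker.starProjection_apply_mem x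
  rw [Submodule.starProjection_orthogonal_val, map_sub, hker, sub_zero]

variable {P}

theorem starProjection_orthogonal_ker_eq_of_apply_eq {x y : E} (h : P x = P y) :
    P.kerᗮ.starProjection x = P.kerᗮ.starProjection y := by
  have hker : x - y ∈ P.ker := by simpa [sub_eq_zero] using h
  rw [← sub_eq_zero, ← map_sub, Submodule.starProjection_apply_eq_zero_iff]
  exact P.ker.le_orthogonal_orthogonal hker

end KerOrthogonal

section Modulus

variable {E F : Type*} [NormedAddCommGroup E] [InnerProductSpace ℂ E] [CompleteSpace E]
  [NormedAddCommGroup F] [InnerProductSpace ℂ F] [CompleteSpace F]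

/-- The modulus `|W| = (W* W)^{1/2}` of a bounded operator `W` between Hilbert spaces. -/
noncomputable def modulus (W : E →L[ℂ] F) : E →L[ℂ] E :=
  CFC.sqrt (adjoint W ∘L W)

theorem isSelfAdjoint_modulus (W : E →L[ℂ] F) : IsSelfAdjoint (modulus W) :=
  .of_nonneg (CFC.sqrt_nonneg _)

theorem modulus_comp_modulus (W : E →L[ℂ] F) : modulus W ∘L modulus W = adjoint W ∘L W :=
  CFC.sqrt_mul_sqrt_self _ ((nonneg_iff_isPositive _).2 (isPositive_adjoint_comp_self W))

theorem norm_modulus_apply (W : E →L[ℂ] F) (x : E) : ‖modulus W x‖ = ‖W x‖ := by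
  rw [← sq_eq_sq₀ (norm_nonneg _) (norm_nonneg _), apply_norm_sq_eq_inner_adjoint_left,
    apply_norm_sq_eq_inner_adjoint_left, (isSelfAdjoint_modulus W).adjoint_eq,
    modulus_comp_modulus]

theorem isUnit_modulus {W : E →L[ℂ] F} {c : ℝ≥0} (hW : AntilipschitzWith c W) :
    IsUnit (modulus W) := by
  have hanti : AntilipschitzWith c (modulus W) :=
    (modulus W).antilipschitz_of_bound fun x => by
      simpa only [norm_modulus_apply] using hW.le_mul_norm (map_zero W) x
  have hdense : (modulus W).range.topologicalClosure = ⊤ := by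
    rw [Submodule.topologicalClosure_eq_top_iff, orthogonal_range,
      (isSelfAdjoint_modulus W).adjoint_eq]
    exact LinearMap.ker_eq_bot.2 hanti.injective
  rw [isUnit_iff_bijective, bijective_iff_dense_range_and_antilipschitz]
  exact ⟨hdense, c, hanti⟩

end Modulus

section Boundedness

variable {E F G : Type*} [NormedAddCommGroup E] [InnerProductSpace ℂ E]
  [NormedAddCommGroup F] [InnerProductSpace ℂ F] [NormedAddCommGroup G] [InnerProductSpace ℂ G]
  {S : E →L[ℂ] E} {R : F →L[ℂ] F} {V : G →L[ℂ] G} {P : E →L[ℂ] F}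

theorem PowerBounded.of_quotient {J : F →L[ℂ] E} (hPJ : P ∘L J = .id ℂ F)
    (hP : P ∘L S = R ∘L P) (hS : PowerBounded S) : PowerBounded R := by
  obtain ⟨C, hC⟩ := hS
  refine ⟨‖P‖ * ‖J‖ * C, fun n hn => ?_⟩
  calc ‖R ^ n‖ ≤ ‖P‖ * ‖J‖ * ‖S ^ n‖ := by
        simpa only [map_pow, aeval_X] using norm_aeval_le_of_quotient hPJ hP (X ^ n)
    _ ≤ ‖P‖ * ‖J‖ * C := by gcongr; exact hC n hn

theorem PowerBounded.of_subdirectSum {Q : E →L[ℂ] G} {Z₁ : F →L[ℂ] E} {Z₂ : G →L[ℂ] E}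
    (hZ : Z₁ ∘L P + Z₂ ∘L Q = .id ℂ E) (hP : P ∘L S = R ∘L P) (hQ : Q ∘L S = V ∘L Q)
    (hR : PowerBounded R) (hV : PowerBounded V) : PowerBounded S := by
  obtain ⟨C, hC⟩ := hR
  obtain ⟨D, hD⟩ := hV
  refine ⟨‖Z₁‖ * ‖P‖ * C + ‖Z₂‖ * ‖Q‖ * D, fun n hn => ?_⟩
  calc ‖S ^ n‖ ≤ ‖Z₁‖ * ‖P‖ * ‖R ^ n‖ + ‖Z₂‖ * ‖Q‖ * ‖V ^ n‖ := by
        simpa only [map_pow, aeval_X] using norm_aeval_le_of_subdirectSum hZ hP hQ (X ^ n)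
    _ ≤ ‖Z₁‖ * ‖P‖ * C + ‖Z₂‖ * ‖Q‖ * D := by gcongr; exacts [hC n hn, hD n hn]

theorem PolynomiallyBounded.of_norm_aeval_le {M : ℝ}
    (h : ∀ p : ℂ[X], ‖aeval S p‖ ≤ M * ⨆ z : Metric.closedBall (0 : ℂ) 1, ‖p.eval (z : ℂ)‖) :
    PolynomiallyBounded S := by
  refine ⟨max M 1, by positivity, fun p => (h p).trans ?_⟩
  gcongr
  · exact Real.iSup_nonneg fun _ => norm_nonneg _
  · exact le_max_left M 1

theorem PolynomiallyBounded.of_quotient {J : F →L[ℂ] E} (hPJ : P ∘L J = .id ℂ F)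
    (hP : P ∘L S = R ∘L P) (hS : PolynomiallyBounded S) : PolynomiallyBounded R := by
  obtain ⟨M, -, hM⟩ := hS
  refine .of_norm_aeval_le (M := ‖P‖ * ‖J‖ * M) fun p => ?_
  rw [mul_assoc _ M]
  exact (norm_aeval_le_of_quotient hPJ hP p).trans (by gcongr; exact hM p)

theorem PolynomiallyBounded.of_subdirectSum {Q : E →L[ℂ] G} {Z₁ : F →L[ℂ] E} {Z₂ : G →L[ℂ] E}
    (hZ : Z₁ ∘L P + Z₂ ∘L Q = .id ℂ E) (hP : P ∘L S = R ∘L P) (hQ : Q ∘L S = V ∘L Q)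
    (hR : PolynomiallyBounded R) (hV : PolynomiallyBounded V) : PolynomiallyBounded S := by
  obtain ⟨M, -, hM⟩ := hR
  obtain ⟨N, -, hN⟩ := hV
  refine .of_norm_aeval_le (M := ‖Z₁‖ * ‖P‖ * M + ‖Z₂‖ * ‖Q‖ * N) fun p => ?_
  rw [add_mul, mul_assoc _ M, mul_assoc _ N]
  exact (norm_aeval_le_of_subdirectSum hZ hP hQ p).trans (by gcongr; exacts [hM p, hN p])

end Boundedness

section Contractions

variable {E F G : Type*} [NormedAddCommGroup E] [InnerProductSpace ℂ E]
  [NormedAddCommGroup F] [InnerProductSpace ℂ F] [NormedAddCommGroup G] [InnerProductSpace ℂ G]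
  {S : E →L[ℂ] E} {R : F →L[ℂ] F} {V : G →L[ℂ] G} {P : E →L[ℂ] F}

theorem SimilarToContraction.of_norm_le_one [CompleteSpace E] (hS : ‖S‖ ≤ 1) :
    SimilarToContraction S :=
  ⟨E, _, _, ‹_›, S, hS, .refl ℂ E, rfl⟩

theorem SimilarToContraction.of_antilipschitz [CompleteSpace E] [CompleteSpace F]
    {W : E →L[ℂ] F} {c : ℝ≥0} (hW : AntilipschitzWith c W) (hS : ∀ x, ‖W (S x)‖ ≤ ‖W x‖) :
    SimilarToContraction S := by
  -- Conjugating by `|W|` keeps the space `E`, hence its universe; the operator that `S` induces on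
  -- the range of `W` would live in the universe of `F`.
  let Y : E ≃L[ℂ] E := .ofUnit (isUnit_modulus hW).unit
  have hY : ∀ x, ‖Y x‖ = ‖W x‖ := norm_modulus_apply W
  refine ⟨E, _, _, ‹_›, Y ∘L S ∘L Y.symm, opNorm_le_bound _ zero_le_one fun x => ?_, Y, ?_⟩
  · calc ‖Y (S (Y.symm x))‖ = ‖W (S (Y.symm x))‖ := hY _
      _ ≤ ‖W (Y.symm x)‖ := hS _
      _ = 1 * ‖x‖ := by rw [← hY, Y.apply_symm_apply, one_mul]
  · ext x
    simp

theorem SimilarToContraction.of_leftInverse [CompleteSpace F] {W : E →L[ℂ] F} {Z : F →L[ℂ] E}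
    (hZW : Function.LeftInverse Z W) (hS : ∀ x, ‖W (S x)‖ ≤ ‖W x‖) :
    SimilarToContraction S :=
  have := completeSpace_of_leftInverse hZW W.uniformContinuous Z.continuous
  .of_antilipschitz (Z.lipschitz.to_rightInverse hZW) hS

theorem SimilarToContraction.of_quotient_of_norm_le_one [CompleteSpace E] (hS : ‖S‖ ≤ 1)
    {J : F →L[ℂ] E} (hPJ : P ∘L J = .id ℂ F) (hP : P ∘L S = R ∘L P) :
    SimilarToContraction R := by
  -- `Q ∘L J` lifts each vector to its preimage of least norm, so `‖Q (J y)‖` is the quotient norm.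
  let Q : E →L[ℂ] E := P.kerᗮ.starProjection
  have hPQ (x : E) : P (Q x) = P x := apply_starProjection_orthogonal_ker P x
  have hPJ' : Function.LeftInverse P J := DFunLike.congr_fun hPJ
  have hP' : Function.Semiconj P S R := DFunLike.congr_fun hP
  refine .of_leftInverse (W := Q ∘L J) (Z := P) (fun y => (hPQ _).trans (hPJ' y)) fun y => ?_
  calc ‖Q (J (R y))‖ = ‖Q (S (Q (J y)))‖ := by
        congr 1
        apply starProjection_orthogonal_ker_eq_of_apply_eq
        rw [hPJ', hP', hPQ, hPJ']
    _ ≤ ‖S (Q (J y))‖ := Submodule.norm_starProjection_apply_le _ _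
    _ ≤ ‖Q (J y)‖ := by simpa only [one_mul] using S.le_of_opNorm_le hS (Q (J y))

theorem SimilarToContraction.of_quotient {J : F →L[ℂ] E} (hPJ : P ∘L J = .id ℂ F)
    (hP : P ∘L S = R ∘L P) (hS : SimilarToContraction S) : SimilarToContraction R := by
  obtain ⟨L, _, _, _, T, hT, Y, hY⟩ := hS
  refine .of_quotient_of_norm_le_one hT (P := P ∘L Y.symm) (J := Y ∘L J) ?_ ?_
  · ext y
    simpa using DFunLike.congr_fun hPJ y
  · ext x
    have hTY : T x = Y (S (Y.symm x)) := by simpa using (DFunLike.congr_fun hY (Y.symm x)).symm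
    simpa [hTY] using DFunLike.congr_fun hP (Y.symm x)

theorem SimilarToContraction.of_subdirectSum {Q : E →L[ℂ] G} {Z₁ : F →L[ℂ] E} {Z₂ : G →L[ℂ] E}
    (hZ : Z₁ ∘L P + Z₂ ∘L Q = .id ℂ E) (hP : P ∘L S = R ∘L P) (hQ : Q ∘L S = V ∘L Q)
    (hR : SimilarToContraction R) (hV : SimilarToContraction V) : SimilarToContraction S := by
  obtain ⟨L, _, _, _, T, hT, Y, hY⟩ := hR
  obtain ⟨L', _, _, _, T', hT', Y', hY'⟩ := hV
  have hYP (x : E) : Y (P (S x)) = T (Y (P x)) :=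
    (congrArg Y (DFunLike.congr_fun hP x)).trans (DFunLike.congr_fun hY (P x))
  have hYQ (x : E) : Y' (Q (S x)) = T' (Y' (Q x)) :=
    (congrArg Y' (DFunLike.congr_fun hQ x)).trans (DFunLike.congr_fun hY' (Q x))
  let W : E →L[ℂ] WithLp 2 (L × L') :=
    (WithLp.prodContinuousLinearEquiv 2 ℂ L L').symm ∘L
      ((Y : F →L[ℂ] L) ∘L P).prod ((Y' : G →L[ℂ] L') ∘L Q)
  let Z : WithLp 2 (L × L') →L[ℂ] E :=
    Z₁ ∘L Y.symm ∘L WithLp.fstL 2 ℂ L L' + Z₂ ∘L Y'.symm ∘L WithLp.sndL 2 ℂ L L'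
  have hZW : Function.LeftInverse Z W := fun x => by
    simpa [Z, W] using DFunLike.congr_fun hZ x
  have hW (x : E) : ‖W x‖ ^ 2 = ‖Y (P x)‖ ^ 2 + ‖Y' (Q x)‖ ^ 2 :=
    WithLp.prod_norm_sq_eq_of_L2 (W x)
  refine .of_leftInverse hZW fun x => ?_
  rw [← sq_le_sq₀ (norm_nonneg _) (norm_nonneg _), hW, hW, hYP, hYQ]
  gcongr
  · simpa only [one_mul] using T.le_of_opNorm_le hT (Y (P x))
  · simpa only [one_mul] using T'.le_of_opNorm_le hT' (Y' (Q x))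

end Contractions

section Blocks

variable (E F G : Type*) [NormedAddCommGroup E] [InnerProductSpace ℂ E]
  [NormedAddCommGroup F] [InnerProductSpace ℂ F] [NormedAddCommGroup G] [InnerProductSpace ℂ G]

/-- The projection of `E ⊕ (F ⊕ G)` onto `E ⊕ G`. -/
noncomputable def outerProj : WithLp 2 (E × WithLp 2 (F × G)) →L[ℂ] WithLp 2 (E × G) :=
  WithLp.sndL 2 ℂ F (WithLp 2 (E × G)) ∘L
    (reorder E F G).toContinuousLinearEquiv

/-- The inclusion of `E ⊕ G` into `E ⊕ (F ⊕ G)`. -/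
noncomputable def outerIncl : WithLp 2 (E × G) →L[ℂ] WithLp 2 (E × WithLp 2 (F × G)) :=
  ((WithLp.prodContinuousLinearEquiv 2 ℂ F (WithLp 2 (E × G))).symm.trans
    (reorder E F G).symm.toContinuousLinearEquiv) ∘L .inr ℂ F (WithLp 2 (E × G))

/-- The inclusion of `F` into `E ⊕ (F ⊕ G)`. -/
noncomputable def middleIncl : F →L[ℂ] WithLp 2 (E × WithLp 2 (F × G)) :=
  ((WithLp.prodContinuousLinearEquiv 2 ℂ F (WithLp 2 (E × G))).symm.trans
    (reorder E F G).symm.toContinuousLinearEquiv) ∘L .inl ℂ F (WithLp 2 (E × G))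

theorem outerProj_apply (x : WithLp 2 (E × WithLp 2 (F × G))) :
    outerProj E F G x = WithLp.toLp 2 (x.fst, x.snd.snd) :=
  rfl

theorem outerIncl_apply (x : WithLp 2 (E × G)) :
    outerIncl E F G x = WithLp.toLp 2 (x.fst, WithLp.toLp 2 (0, x.snd)) :=
  rfl

theorem middleIncl_apply (x : F) :
    middleIncl E F G x = WithLp.toLp 2 (0, WithLp.toLp 2 (x, 0)) :=
  rfl

theorem outerProj_comp_outerIncl : outerProj E F G ∘L outerIncl E F G = .id ℂ (WithLp 2 (E × G)) :=
  rfl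

theorem outerIncl_comp_outerProj_add :
    outerIncl E F G ∘L outerProj E F G +
      (middleIncl E F G ∘L WithLp.fstL 2 ℂ F G) ∘L WithLp.sndL 2 ℂ E (WithLp 2 (F × G)) =
      .id ℂ (WithLp 2 (E × WithLp 2 (F × G))) := by
  ext x
  apply (reorder E F G).injective
  simp [outerProj_apply, outerIncl_apply, middleIncl_apply, reorder_apply]

variable {E F G}

theorem sndL_comp_block3 (a₁₁ : E →L[ℂ] E) (a₁₂ : F →L[ℂ] E) (a₁₃ : G →L[ℂ] E)
    (a₂₂ : F →L[ℂ] F) (a₂₃ : G →L[ℂ] F) (a₃₂ : F →L[ℂ] G) (a₃₃ : G →L[ℂ] G) :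
    WithLp.sndL 2 ℂ E (WithLp 2 (F × G)) ∘L
        block3
          a₁₁ a₁₂ a₁₃
          0 a₂₂ a₂₃
          0 a₃₂ a₃₃ =
      block2 a₂₂ a₂₃ a₃₂ a₃₃ ∘L WithLp.sndL 2 ℂ E (WithLp 2 (F × G)) := by
  ext x
  simp [block3_apply, block2_apply]

variable (a₁₁ : E →L[ℂ] E) (a₁₃ : G →L[ℂ] E) (a₂₁ : E →L[ℂ] F) (a₂₂ : F →L[ℂ] F)
  (a₂₃ : G →L[ℂ] F) (a₃₁ : E →L[ℂ] G) (a₃₃ : G →L[ℂ] G)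

theorem block3_mem_middleSummand {x : WithLp 2 (E × WithLp 2 (F × G))}
    (hx : x ∈ middleSummand E F G) :
    block3
      a₁₁ 0 a₁₃
      a₂₁ a₂₂ a₂₃
      a₃₁ 0 a₃₃ x ∈ middleSummand E F G := by
  obtain ⟨hfst, hsnd⟩ := hx
  constructor <;> simp [block3_apply, hfst, hsnd]

theorem reorder_block3 (x : WithLp 2 (E × WithLp 2 (F × G))) :
    reorder E F G (block3
      a₁₁ 0 a₁₃
      a₂₁ a₂₂ a₂₃
      a₃₁ 0 a₃₃ x) =
      block2
        a₂₂ (a₂₁ ∘L WithLp.fstL 2 ℂ E G + a₂₃ ∘L WithLp.sndL 2 ℂ E G)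
        0 (block2 a₁₁ a₁₃ a₃₁ a₃₃) (reorder E F G x) := by
  simp [reorder_apply, block3_apply, block2_apply, add_left_comm, add_assoc]

theorem outerProj_comp_block3 :
    outerProj E F G ∘L
        block3
          a₁₁ 0 a₁₃
          a₂₁ a₂₂ a₂₃
          a₃₁ 0 a₃₃ =
      block2 a₁₁ a₁₃ a₃₁ a₃₃ ∘L outerProj E F G := by
  ext x
  simp [outerProj_apply, block3_apply, block2_apply]

end Blocks

end BlockOperators

open BlockOperators in
theorem proposition2p5_general
    {H₀ : Type*} {H₁ : Type*} {K₁ : Type*}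
    [NormedAddCommGroup H₀] [InnerProductSpace ℂ H₀]
    [NormedAddCommGroup H₁] [InnerProductSpace ℂ H₁]
    [NormedAddCommGroup K₁] [InnerProductSpace ℂ K₁]
    (T₀ : H₀ →L[ℂ] H₀) (T₁ : H₁ →L[ℂ] H₁) (V₁ : K₁ →L[ℂ] K₁)
    (K : H₁ →L[ℂ] K₁) (A : H₁ →L[ℂ] H₀)
    (V : WithLp 2 (K₁ × H₁) →L[ℂ] WithLp 2 (K₁ × H₁))
    (hV : V = block2
      V₁ K
      0  T₁)
    (R : WithLp 2 (H₀ × H₁) →L[ℂ] WithLp 2 (H₀ × H₁))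
    (hR : R = block2
      T₀ A
      0  T₁)
    (R₀ : WithLp 2 (H₀ × WithLp 2 (K₁ × H₁)) →L[ℂ] WithLp 2 (H₀ × WithLp 2 (K₁ × H₁)))
    (hR₀ : R₀ = block3
      T₀ 0  A
      0  V₁ K
      0  0  T₁) :
    (∀ x ∈ middleSummand H₀ K₁ H₁, R₀ x ∈ middleSummand H₀ K₁ H₁) ∧
    (∃ B : WithLp 2 (H₀ × H₁) →L[ℂ] K₁, ∀ x,
      reorder H₀ K₁ H₁ (R₀ x) =
        block2
          V₁ B
          0  R (reorder H₀ K₁ H₁ x)) ∧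
    (PowerBounded V → (PowerBounded R ↔ PowerBounded R₀)) ∧
    (PolynomiallyBounded V → (PolynomiallyBounded R ↔ PolynomiallyBounded R₀)) ∧
    (SimilarToContraction V → (SimilarToContraction R ↔ SimilarToContraction R₀)) := by
  subst hV hR hR₀
  have hP := outerProj_comp_block3 T₀ A 0 V₁ K 0 T₁
  have hQ := sndL_comp_block3 T₀ 0 A V₁ K 0 T₁
  have hPJ := outerProj_comp_outerIncl H₀ K₁ H₁
  have hZ := outerIncl_comp_outerProj_add H₀ K₁ H₁
  exact ⟨fun _ => block3_mem_middleSummand T₀ A 0 V₁ K 0 T₁,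
    ⟨_, reorder_block3 T₀ A 0 V₁ K 0 T₁⟩,
    fun hV => ⟨fun hR => .of_subdirectSum hZ hP hQ hR hV, .of_quotient hPJ hP⟩,
    fun hV => ⟨fun hR => .of_subdirectSum hZ hP hQ hR hV, .of_quotient hPJ hP⟩,
    fun hV => ⟨fun hR => .of_subdirectSum hZ hP hQ hR hV, .of_quotient hPJ hP⟩⟩

theorem proposition2p5
    {H₀ : Type*} {H₁ : Type*} {K₁ : Type*}
    [NormedAddCommGroup H₀] [InnerProductSpace ℂ H₀] [CompleteSpace H₀]
    [NormedAddCommGroup H₁] [InnerProductSpace ℂ H₁] [CompleteSpace H₁]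
    [NormedAddCommGroup K₁] [InnerProductSpace ℂ K₁] [CompleteSpace K₁]
    (T₀ : H₀ →L[ℂ] H₀) (T₁ : H₁ →L[ℂ] H₁) (V₁ : K₁ →L[ℂ] K₁)
    (K : H₁ →L[ℂ] K₁) (A : H₁ →L[ℂ] H₀)
    (V : WithLp 2 (K₁ × H₁) →L[ℂ] WithLp 2 (K₁ × H₁))
    (hV : V = BlockOperators.block2
      V₁ K
      0  T₁)
    (R : WithLp 2 (H₀ × H₁) →L[ℂ] WithLp 2 (H₀ × H₁))
    (hR : R = BlockOperators.block2
      T₀ A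
      0  T₁)
    (R₀ : WithLp 2 (H₀ × WithLp 2 (K₁ × H₁)) →L[ℂ] WithLp 2 (H₀ × WithLp 2 (K₁ × H₁)))
    (hR₀ : R₀ = BlockOperators.block3
      T₀ 0  A
      0  V₁ K
      0  0  T₁) :
    -- `K₁` is an invariant subspace of `R₀`
    (∀ x ∈ BlockOperators.middleSummand H₀ K₁ H₁,
      R₀ x ∈ BlockOperators.middleSummand H₀ K₁ H₁) ∧
    -- the form of `R₀` with respect to `K₁ ⊕ H`, where `H = H₀ ⊕ H₁`
    (∃ B : WithLp 2 (H₀ × H₁) →L[ℂ] K₁, ∀ x,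
      BlockOperators.reorder H₀ K₁ H₁ (R₀ x) =
        BlockOperators.block2
          V₁ B
          0  R (BlockOperators.reorder H₀ K₁ H₁ x)) ∧
    -- (1)
    (BlockOperators.PowerBounded V →
      (BlockOperators.PowerBounded R ↔ BlockOperators.PowerBounded R₀)) ∧
    (BlockOperators.PolynomiallyBounded V →
      (BlockOperators.PolynomiallyBounded R ↔ BlockOperators.PolynomiallyBounded R₀)) ∧
    -- (2)
    (Isometry V →
      (BlockOperators.SimilarToContraction R ↔ BlockOperators.SimilarToContraction R₀)) := by
  obtain ⟨hinv, hform, hpow, hpoly, hsim⟩ :=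
    proposition2p5_general T₀ T₁ V₁ K A V hV R hR R₀ hR₀
  exact ⟨hinv, hform, hpow, hpoly, fun hiso =>
    hsim (.of_norm_le_one (V.opNorm_le_of_lipschitz hiso.lipschitz))⟩
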